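/- Let $V$ be a finite set and let $\mathcal{C}=(V,\mathcal{R})$ be a coherent configuration (scheme), not necessarily homogeneous: $\mathcal{R}$ is a set of nonempty binary relations on $V$ that partitions $V\times V$, the diagonal of $V\times V$ is a union of elements of $\mathcal{R}$, $R^t=\{(v,u):(u,v)\in R\}\in\mathcal{R}$ for every $R\in\mathcal{R}$, and for all $R,S,T\in\mathcal{R}$ the number $|\{v\in V:(u,v)\in R,\ (v,w)\in S\}|$ is the same for all $(u,w)\in T$. Let $W\subseteq \mathrm{Mat}_V(\mathbb{Z})$ be the adjacency ring of $\mathcal{C}$, that is, the $\mathbb{Z}$-span of the adjacency matrices $A(R)$, $R\in\mathcal{R}$, and for a field $k$ let $W^k=k\otimes_{\mathbb{Z}}W$ be the adjacency algebra over $k$. Let $M_1,\dots,M_r$ be representatives of the isomorphism classes of irreducible right $W^{\mathbb{C}}$-modules, let $f_i=\dim_{\mathbb{C}}M_i$, and let $m_i$ be the multiplicity of $M_i$ in the standard module $\mathbb{C}V$, on which $W^{\mathbb{C}}$ acts from the right by $uA=\sum_{v\in V}A_{u,v}\,v$, so that $\mathbb{C}V\cong\bigoplus_{i=1}^r m_iM_i$.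 Then the Frame number $$\mathcal{F}(\mathcal{C})=\frac{\prod_{R\in\mathcal{R}}|R|}{\prod_{i=1}^r m_i^{f_i^2}}$$ is an integer, and for every field $k$ of characteristic $p$ (with $p$ a prime or $p=0$) the algebra $W^k$ is semisimple if and only if $p$ does not divide $\mathcal{F}(\mathcal{C})$. -/

import Mathlib

open scoped TensorProduct Matrix

/-- A coherent configuration (scheme) on a finite set `V`. -/
structure CoherentConfiguration (V : Type*) [Fintype V] [DecidableEq V] where
  /-- the set of basis relations -/
  rels : Finset (Finset (V × V))
  nonempty_of_mem : ∀ R ∈ rels, R.Nonempty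
  /-- the basis relations partition `V × V` -/
  existsUnique_mem : ∀ x : V × V, ∃! R, R ∈ rels ∧ x ∈ R
  /-- the diagonal is a union of basis relations -/
  diag_eq_union : ∃ D ⊆ rels, D.biUnion id = (Finset.univ : Finset V).diag
  transpose_mem : ∀ R ∈ rels, R.image Prod.swap ∈ rels
  /-- the intersection numbers are well defined -/
  coherent : ∀ R ∈ rels, ∀ S ∈ rels, ∀ T ∈ rels, ∀ u w u' w' : V,
    (u, w) ∈ T → (u', w') ∈ T →
      (Finset.univ.filter fun v => (u, v) ∈ R ∧ (v, w) ∈ S).card =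
        (Finset.univ.filter fun v => (u', v) ∈ R ∧ (v, w') ∈ S).card

/-- The adjacency matrix of a binary relation. -/
def adjacencyMatrix {V : Type*} [DecidableEq V] (R : Finset (V × V)) : Matrix V V ℤ :=
  Matrix.of fun u v => if (u, v) ∈ R then 1 else 0

section Modules

variable (B : Type*) [Ring B]

/-- Maximal left ideals `I`, `J` of `B` are identified when the simple modules `B ⧸ I` and `B ⧸ J`
are isomorphic. -/
def simpleModuleSetoid : Setoid {I : Submodule B B // IsCoatom I} where
  r I J := Nonempty ((B ⧸ I.1) ≃ₗ[B] (B ⧸ J.1))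
  iseqv := ⟨fun _ => ⟨LinearEquiv.refl _ _⟩, fun ⟨e⟩ => ⟨e.symm⟩, fun ⟨e⟩ ⟨f⟩ => ⟨e.trans f⟩⟩

/-- The isomorphism classes of simple left `B`-modules: every simple module is isomorphic to
`B ⧸ I` for some maximal left ideal `I`. -/
def Irr : Type _ := Quotient (simpleModuleSetoid B)

variable {B}

/-- A simple module representing a given isomorphism class. -/
abbrev Irr.Rep (i : Irr B) : Type _ := B ⧸ (Quotient.out i).1

/-- The multiplicity of a simple module in a module `N`: the number of summands in a decomposition
of the isotypic component of `N` into simple modules. -/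
noncomputable def Irr.multiplicity (i : Irr B) (N : Type*) [AddCommGroup N] [Module B N] : ℕ :=
  (Module.length B (isotypicComponent B N i.Rep)).toNat

end Modules

namespace CoherentConfiguration

variable {V : Type*} [Fintype V] [DecidableEq V] (C : CoherentConfiguration V)

/-- The `ℤ`-span of the adjacency matrices of the basis relations. -/
def adjacencyModule : Submodule ℤ (Matrix V V ℤ) :=
  Submodule.span ℤ (adjacencyMatrix '' (C.rels : Set (Finset (V × V))))

theorem mem_adjacencyModule_of_const (M : Matrix V V ℤ)
    (h : ∀ T ∈ C.rels, ∀ u w u' w' : V, (u, w) ∈ T → (u', w') ∈ T → M u w = M u' w') :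
    M ∈ C.adjacencyModule := by
  classical
  let c : Finset (V × V) → ℤ := fun T => if hT : T.Nonempty then M hT.choose.1 hT.choose.2 else 0
  have hM : M = ∑ T ∈ C.rels, c T • adjacencyMatrix T := by
    ext u w
    obtain ⟨T, ⟨hT, hx⟩, huniq⟩ := C.existsUnique_mem (u, w)
    rw [Matrix.sum_apply, Finset.sum_eq_single T]
    · have hne : T.Nonempty := ⟨_, hx⟩
      have := h T hT u w hne.choose.1 hne.choose.2 hx hne.choose_spec
      simp [c, adjacencyMatrix, hx, hne, this]
    · intro S hS hST
      have : (u, w) ∉ S := fun hS' => hST (huniq S ⟨hS, hS'⟩)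
      simp [adjacencyMatrix, this]
    · exact fun hT' => absurd hT hT'
  rw [hM]
  exact Submodule.sum_mem _ fun T hT =>
    Submodule.smul_mem _ _ (Submodule.subset_span ⟨T, hT, rfl⟩)

theorem one_mem_adjacencyModule : (1 : Matrix V V ℤ) ∈ C.adjacencyModule := by
  obtain ⟨D, hD, hdiag⟩ := C.diag_eq_union
  have key : ∀ T ∈ C.rels, ∀ u w u' w' : V, (u, w) ∈ T → (u', w') ∈ T → u = w → u' = w' := by
    rintro T hT u w u' w' h1 h2 rfl
    have : (u, u) ∈ D.biUnion id := by rw [hdiag]; simp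
    obtain ⟨S, hS, hu⟩ := Finset.mem_biUnion.1 this
    have hTS : T = S := (C.existsUnique_mem (u, u)).unique ⟨hT, h1⟩ ⟨hD hS, hu⟩
    have : (u', w') ∈ D.biUnion id := Finset.mem_biUnion.2 ⟨S, hS, by simpa [← hTS] using h2⟩
    rw [hdiag] at this
    simpa using this
  refine C.mem_adjacencyModule_of_const _ fun T hT u w u' w' h1 h2 => ?_
  have : u = w ↔ u' = w' := ⟨key T hT _ _ _ _ h1 h2, key T hT _ _ _ _ h2 h1⟩
  simp [Matrix.one_apply, this]

theorem mul_mem_adjacencyModule (M N : Matrix V V ℤ) (hM : M ∈ C.adjacencyModule)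
    (hN : N ∈ C.adjacencyModule) : M * N ∈ C.adjacencyModule := by
  have h := Submodule.mul_mem_mul hM hN
  rw [adjacencyModule, Submodule.span_mul_span] at h
  refine Submodule.span_le.2 ?_ h
  rintro _ ⟨_, ⟨R, hR, rfl⟩, _, ⟨S, hS, rfl⟩, rfl⟩
  refine C.mem_adjacencyModule_of_const _ fun T hT u w u' w' h1 h2 => ?_
  have := C.coherent R hR S hS T hT u w u' w' h1 h2
  have e : ∀ a b : V, (adjacencyMatrix R * adjacencyMatrix S) a b =
      ((Finset.univ.filter fun v => (a, v) ∈ R ∧ (v, b) ∈ S).card : ℤ) := by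
    intro a b
    simp only [Matrix.mul_apply, adjacencyMatrix, Matrix.of_apply, Finset.card_filter,
      Nat.cast_sum]
    refine Finset.sum_congr rfl fun v _ => ?_
    by_cases ha : (a, v) ∈ R <;> by_cases hb : (v, b) ∈ S <;> simp [ha, hb]
  change (adjacencyMatrix R * adjacencyMatrix S) u w = (adjacencyMatrix R * adjacencyMatrix S) u' w'
  rw [e, e, this]

/-- The adjacency ring `W` of a scheme. -/
def adjacencyRing : Subalgebra ℤ (Matrix V V ℤ) :=
  C.adjacencyModule.toSubalgebra C.one_mem_adjacencyModule C.mul_mem_adjacencyModule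

/-- The adjacency algebra `k ⊗ W` over a field `k`. -/
abbrev adjacencyAlgebra (k : Type*) [Field k] : Type _ := k ⊗[ℤ] C.adjacencyRing

/-- The natural map `k ⊗ W → Mat_V(k)`. -/
noncomputable def toMatrix (k : Type*) [Field k] :
    C.adjacencyAlgebra k →ₐ[k] Matrix V V k :=
  Algebra.TensorProduct.lift (Algebra.ofId k (Matrix V V k))
    ((AlgHom.mapMatrix (Algebra.ofId ℤ k)).comp C.adjacencyRing.val)
    (fun a _ => by
      rw [Algebra.ofId_apply]
      exact Algebra.commute_algebraMap_left a _)

/-- The standard module `kV`, with basis `V`. -/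
def StandardModule (_ : CoherentConfiguration V) (k : Type*) [Field k] : Type _ := V → k

noncomputable instance (k : Type*) [Field k] : AddCommGroup (C.StandardModule k) :=
  inferInstanceAs (AddCommGroup (V → k))

/-- `kV` is a right module over the adjacency algebra (a left module over the opposite algebra):
a matrix `A` sends the basis element `u` to `∑ v, A u v • v`. -/
noncomputable instance (k : Type*) [Field k] :
    Module (C.adjacencyAlgebra k)ᵐᵒᵖ (C.StandardModule k) where
  smul a x := Matrix.vecMul (show V → k from x) (C.toMatrix k a.unop)
  one_smul x := by
    change Matrix.vecMul (show V → k from x) (C.toMatrix k 1) = x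
    rw [map_one]; exact Matrix.vecMul_one _
  mul_smul a b x := by
    change Matrix.vecMul (show V → k from x) (C.toMatrix k (b.unop * a.unop)) =
      Matrix.vecMul (Matrix.vecMul (show V → k from x) (C.toMatrix k b.unop)) (C.toMatrix k a.unop)
    rw [map_mul, Matrix.vecMul_vecMul]
  smul_zero a := Matrix.zero_vecMul _
  smul_add a x y := Matrix.add_vecMul _ _ _
  add_smul a b x := by
    change Matrix.vecMul (show V → k from x) (C.toMatrix k (a.unop + b.unop)) = _
    rw [map_add]; exact Matrix.vecMul_add _ _ _
  zero_smul x := by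
    change Matrix.vecMul (show V → k from x) (C.toMatrix k 0) = _
    rw [map_zero]; exact Matrix.vecMul_zero _

/-- The Frame number `∏ |R| / ∏ mᵢ ^ (fᵢ ^ 2)`, where `i` runs over the isomorphism classes of
irreducible right modules of the adjacency algebra over `ℂ` (there are finitely many), `fᵢ` is the
dimension and `mᵢ` the multiplicity in the standard module. -/
noncomputable def frameNumber : ℚ :=
  (∏ R ∈ C.rels, (R.card : ℚ)) /
    ∏ᶠ i : Irr (C.adjacencyAlgebra ℂ)ᵐᵒᵖ,
      (i.multiplicity (C.StandardModule ℂ) : ℚ) ^ (Module.finrank ℂ i.Rep) ^ 2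

end CoherentConfiguration

/-!
Write `W` for the adjacency ring. The discriminant of the trace form of the standard module in the
basis `A(R)` is `± ∏ |R|`. Over `ℂ` the algebra is a product of matrix algebras, and in matrix units
the same discriminant is `± ∏ mᵢ ^ (fᵢ ^ 2)`; hence the Frame number is, up to sign, the square of
the determinant of the change of basis. Finitely generated torsion-free modules over a valuation
ring `O` of `ℂ` are free, so all irreducible representations can be realized over `O`, and this
determinant then lies in `O`. As `O` varies this makes the Frame number integral over `ℤ`.

If `O` has residue field `κ` of characteristic `p`, the determinant is a unit precisely when the
reduced representations give an isomorphism of `κ ⊗ W` with a product of matrix algebras. An element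
killed by all of them is nilpotent, because a lift of it is annihilated by the product of its
characteristic polynomials, so this holds as soon as `κ ⊗ W` is semisimple. Finally, finite fields
being perfect, semisimplicity of `k ⊗ W` depends only on the characteristic of `k`.
-/

section Semisimple

theorem eq_zero_of_forall_isNilpotent_mul {A : Type*} [Ring A] [IsSemisimpleRing A] {x : A}
    (hx : ∀ a, IsNilpotent (a * x)) : x = 0 := by
  have h : x ∈ Ring.jacobson A := by
    rw [← Ideal.jacobson_bot, Ideal.mem_jacobson_iff]
    intro y
    obtain ⟨z, hz⟩ := (hx y).isUnit_one_add.exists_left_inv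
    exact ⟨z, by rw [Ideal.mem_bot, ← hz]; noncomm_ring⟩
  rwa [IsArtinianRing.isSemisimpleRing_iff_jacobson.mp ‹_›] at h

theorem isNilpotent_mul_of_mem_jacobson {A : Type*} [Ring A] [IsArtinianRing A] {x : A}
    (hx : x ∈ Ring.jacobson A) (a : A) : IsNilpotent (a * x) := by
  obtain ⟨n, hn⟩ := IsArtinianRing.isNilpotent_jacobson_bot (R := A)
  rw [Ideal.jacobson_bot] at hn
  have h : (a * x) ^ n ∈ Ring.jacobson A ^ n := Ideal.pow_mem_pow (Ideal.mul_mem_left _ a hx) n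
  rw [hn] at h
  exact ⟨n, h⟩

theorem isSemisimpleRing_of_forall_isNilpotent_mul {A : Type*} [Ring A] [IsArtinianRing A]
    (h : ∀ x : A, (∀ a, IsNilpotent (a * x)) → x = 0) : IsSemisimpleRing A :=
  IsArtinianRing.isSemisimpleRing_iff_jacobson.mpr <|
    eq_bot_iff.mpr fun x hx => h x (isNilpotent_mul_of_mem_jacobson hx)

theorem span_includeRight_image_pow_eq_bot {F A : Type*} (k : Type*) [CommSemiring F]
    [CommSemiring k] [Algebra F k] [Semiring A] [Algebra F A] {I : Ideal A} {n : ℕ}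
    (hI : I ^ n = ⊥) :
    (Submodule.span k
      ((Algebra.TensorProduct.includeRight : A →ₐ[F] k ⊗[F] A) '' (I : Set A))) ^ n = ⊥ := by
  rw [Submodule.span_pow, ← Set.image_pow, Submodule.span_eq_bot]
  rintro _ ⟨x, hx, rfl⟩
  have hx' : x ∈ I ^ n := Submodule.pow_subset_pow I hx
  rw [hI, Submodule.mem_bot] at hx'
  rw [hx', map_zero]

theorem isSemisimpleRing_of_tensorProduct (F k A : Type*) [Field F] [Field k] [Algebra F k]
    [Ring A] [Algebra F A] [FiniteDimensional F A] [IsSemisimpleRing (k ⊗[F] A)] :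
    IsSemisimpleRing A := by
  have := IsArtinianRing.of_finite F A
  obtain ⟨n, hn⟩ := IsArtinianRing.isNilpotent_jacobson_bot (R := A)
  rw [Ideal.jacobson_bot] at hn
  rw [IsArtinianRing.isSemisimpleRing_iff_jacobson, eq_bot_iff]
  intro x hx
  let ι : A →ₐ[F] k ⊗[F] A := Algebra.TensorProduct.includeRight
  let S : Submodule k (k ⊗[F] A) := Submodule.span k (ι '' (Ring.jacobson A : Set A))
  have hmem (b : k ⊗[F] A) : b * ι x ∈ S := by
    induction b using TensorProduct.induction_on with
    | zero => exact (zero_mul (ι x)).symm ▸ S.zero_mem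
    | add a b ha hb => exact (add_mul a b (ι x)).symm ▸ S.add_mem ha hb
    | tmul c a =>
      have h : c ⊗ₜ[F] a * ι x = c • ι (a * x) := by
        simp [ι, Algebra.TensorProduct.tmul_mul_tmul, TensorProduct.smul_tmul']
      exact h ▸ S.smul_mem c (Submodule.subset_span ⟨_, Ideal.mul_mem_left _ a hx, rfl⟩)
  have hzero : ι x = 0 := eq_zero_of_forall_isNilpotent_mul fun b => ⟨n, by
    have h := Submodule.pow_mem_pow S (hmem b) n
    rwa [span_includeRight_image_pow_eq_bot k hn] at h⟩
  exact Algebra.TensorProduct.includeRight_injective (algebraMap F k).injective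
    (hzero.trans (map_zero ι).symm)

theorem isSemisimpleRing_tensorProduct_field (F k L : Type*) [Field F] [PerfectField F]
    [Field k] [Algebra F k] [Field L] [Algebra F L] [FiniteDimensional F L] :
    IsSemisimpleRing (k ⊗[F] L) := by
  have : Algebra.FormallyUnramified F L := .of_isSeparable F L
  have := Algebra.FormallyUnramified.isReduced_of_field k (k ⊗[F] L)
  have := IsArtinianRing.of_finite k (k ⊗[F] L)
  exact IsArtinianRing.isSemisimpleRing_of_isReduced _

theorem isSemisimpleRing_tensorProduct_matrix (F k D : Type*) [Field F] [Finite F] [Field k]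
    [Algebra F k] [DivisionRing D] [Algebra F D] [FiniteDimensional F D] (n : Type*) [Fintype n]
    [DecidableEq n] : IsSemisimpleRing (k ⊗[F] Matrix n n D) := by
  have : Finite D := Module.finite_of_finite F
  let _ : Field D := littleWedderburn D
  have := isSemisimpleRing_tensorProduct_field F k D
  let e : k ⊗[F] Matrix n n D ≃ₐ[F] Matrix n n (k ⊗[F] D) :=
    (Algebra.TensorProduct.congr AlgEquiv.refl (matrixEquivTensor n F D)).trans
      ((Algebra.TensorProduct.assoc F F F k D _).symm.trans
        (matrixEquivTensor n F (k ⊗[F] D)).symm)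
  exact e.symm.toRingEquiv.isSemisimpleRing

theorem isSemisimpleRing_tensorProduct (F k A : Type*) [Field F] [Finite F] [Field k]
    [Algebra F k] [Ring A] [Algebra F A] [FiniteDimensional F A] [IsSemisimpleRing A] :
    IsSemisimpleRing (k ⊗[F] A) := by
  obtain ⟨n, D, d, _, _, _, -, ⟨e⟩⟩ :=
    IsSemisimpleRing.exists_algEquiv_pi_matrix_divisionRing_finite F A
  have := fun i => isSemisimpleRing_tensorProduct_matrix F k (D i) (Fin (d i))
  let e' : k ⊗[F] A ≃ₐ[F] ∀ i, k ⊗[F] Matrix (Fin (d i)) (Fin (d i)) (D i) :=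
    (Algebra.TensorProduct.congr AlgEquiv.refl e).trans (Algebra.TensorProduct.piRight F F k _)
  exact e'.symm.toRingEquiv.isSemisimpleRing

theorem isSemisimpleRing_tensorProduct_iff_zmod (k W : Type*) [Field k] [Ring W]
    [Module.Finite ℤ W] (p : ℕ) [Fact p.Prime] [CharP k p] :
    IsSemisimpleRing (k ⊗[ℤ] W) ↔ IsSemisimpleRing (ZMod p ⊗[ℤ] W) := by
  let _ : Algebra (ZMod p) k := ZMod.algebra k p
  let e : k ⊗[ZMod p] (ZMod p ⊗[ℤ] W) ≃ₐ[k] k ⊗[ℤ] W :=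
    (Algebra.TensorProduct.assoc ℤ (ZMod p) k k (ZMod p) W).symm.trans
      (Algebra.TensorProduct.congr (Algebra.TensorProduct.rid (ZMod p) k k) AlgEquiv.refl)
  constructor
  · intro h
    have : IsSemisimpleRing (k ⊗[ZMod p] (ZMod p ⊗[ℤ] W)) :=
      e.symm.toRingEquiv.isSemisimpleRing
    exact isSemisimpleRing_of_tensorProduct (ZMod p) k _
  · intro h
    have := isSemisimpleRing_tensorProduct (ZMod p) k (ZMod p ⊗[ℤ] W)
    exact RingEquiv.isSemisimpleRing (R := k ⊗[ZMod p] (ZMod p ⊗[ℤ] W)) e.toRingEquiv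

end Semisimple

section Lattice

theorem free_of_isTorsionFree_of_valuationRing (O M : Type*) [CommRing O] [IsDomain O]
    [ValuationRing O] [AddCommGroup M] [Module O M] [Module.Finite O M] [Module.IsTorsionFree O M] :
    Module.Free O M := by
  have : Module.Flat O M := by
    rw [Module.Flat.flat_iff_torsion_eq_bot_of_isBezout,
      ← Submodule.isTorsionFree_iff_torsion_eq_bot]
    infer_instance
  exact Module.free_of_flat_of_isLocalRing

variable {O K W M : Type*} [CommRing O] [Field K] [Algebra O K] [Ring W] [AddCommGroup M]
  [Module K M]

theorem exists_fg_map_le_span_eq_top [Module.Finite K M] [Module.Finite ℤ W]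
    (ρ : W →+* Module.End K M) :
    ∃ G : Submodule ℤ M, G.FG ∧ (∀ w, ∀ x ∈ G, ρ w x ∈ G) ∧
      Submodule.span K (G : Set M) = ⊤ := by
  obtain ⟨s, hs⟩ := Module.Finite.fg_top (R := K) (M := M)
  let β : W →ₗ[ℤ] M →ₗ[ℤ] M :=
    ((LinearMap.restrictScalarsₗ ℤ K M M ℤ).comp ρ.toAddMonoidHom.toIntLinearMap)
  refine ⟨Submodule.map₂ β ⊤ (Submodule.span ℤ s),
    Module.Finite.fg_top.map₂ β ⟨s, rfl⟩, fun w x hx => ?_, ?_⟩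
  · have hle : Submodule.map₂ β ⊤ (Submodule.span ℤ s) ≤
        (Submodule.map₂ β ⊤ (Submodule.span ℤ s)).comap (β w) := by
      refine Submodule.map₂_le.2 fun v _ y hy => ?_
      have h : β w (β v y) = β (w * v) y := (LinearMap.congr_fun (map_mul ρ w v) y).symm
      rw [Submodule.mem_comap, h]
      exact Submodule.apply_mem_map₂ β trivial hy
    exact hle hx
  · refine top_le_iff.1 (hs.symm.le.trans (Submodule.span_mono fun y hy => ?_))
    have h : β 1 y = y := LinearMap.congr_fun (map_one ρ) y
    exact h ▸ Submodule.apply_mem_map₂ β trivial (Submodule.subset_span hy)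

theorem exists_isLattice_forall_apply_mem [Module.Finite K M] [Module O M] [IsScalarTower O K M]
    [Module.Finite ℤ W] (ρ : W →+* Module.End K M) :
    ∃ L : Submodule O M, L.IsLattice K ∧ ∀ w, ∀ x ∈ L, ρ w x ∈ L := by
  obtain ⟨G, ⟨s, rfl⟩, hstable, htop⟩ := exists_fg_map_le_span_eq_top ρ
  let L : Submodule O M := Submodule.span O (Submodule.span ℤ (s : Set M) : Set M)
  refine ⟨L, ⟨⟨s, (Submodule.span_span_of_tower ℤ O _).symm⟩, ?_⟩, fun w => ?_⟩
  · rwa [Submodule.span_span_of_tower]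
  · have hle : L ≤ L.comap ((ρ w).restrictScalars O) :=
      Submodule.span_le.2 fun x hx => Submodule.subset_span (hstable w x hx)
    exact fun x hx => hle hx

variable [Module O M] [IsScalarTower O K M] [IsFractionRing O K] {L : Submodule O M} [L.IsLattice K]
  {ι : Type*} (b : Module.Basis ι O L)

theorem extendOfIsLattice_repr (x : L) (i : ι) :
    (b.extendOfIsLattice K).repr x i = algebraMap O K (b.repr x i) := by
  have h : ((b.extendOfIsLattice K).repr.toLinearMap.restrictScalars O) ∘ₗ L.subtype =
      Finsupp.mapRange.linearMap (Algebra.linearMap O K) ∘ₗ b.repr.toLinearMap := by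
    refine b.ext fun j => ?_
    simp only [LinearMap.comp_apply, Submodule.subtype_apply, LinearMap.restrictScalars_apply,
      LinearEquiv.coe_coe, Module.Basis.repr_self, Finsupp.mapRange.linearMap_apply,
      Finsupp.mapRange_single, Algebra.linearMap_apply, map_one]
    rw [← b.extendOfIsLattice_apply K j, Module.Basis.repr_self]
  exact DFunLike.congr_fun (LinearMap.congr_fun h x) i

theorem toMatrix_extendOfIsLattice [Fintype ι] [DecidableEq ι] (f : Module.End K M)
    (hf : ∀ x ∈ L, f.restrictScalars O x ∈ L) :
    LinearMap.toMatrix (b.extendOfIsLattice K) (b.extendOfIsLattice K) f =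
      (LinearMap.toMatrix b b ((f.restrictScalars O).restrict hf)).map (algebraMap O K) := by
  ext i j
  rw [LinearMap.toMatrix_apply, Matrix.map_apply, LinearMap.toMatrix_apply,
    ← extendOfIsLattice_repr, Module.Basis.extendOfIsLattice_apply]
  rfl

theorem exists_integral_matrix_representation (O : Type*) {K W M : Type*} [CommRing O] [IsDomain O]
    [ValuationRing O] [Field K] [Algebra O K] [IsFractionRing O K] [Ring W] [Module.Finite ℤ W]
    [AddCommGroup M] [Module K M] [Module.Finite K M] (ρ : W →+* Module.End K M) :
    ∃ (b : Module.Basis (Fin (Module.finrank K M)) K M)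
      (ψ : W →+* Matrix (Fin (Module.finrank K M)) (Fin (Module.finrank K M)) O),
      ∀ w, (ψ w).map (algebraMap O K) = LinearMap.toMatrix b b (ρ w) := by
  let _ : Module O M := Module.compHom M (algebraMap O K)
  have : IsScalarTower O K M := .of_algebraMap_smul fun _ _ => rfl
  obtain ⟨L, _, hL⟩ := exists_isLattice_forall_apply_mem (O := O) ρ
  have : Module.IsTorsionFree O M := .trans_faithfulSMul O K M
  have : Module.Finite O L := Submodule.IsLattice.finite K L
  have := free_of_isTorsionFree_of_valuationRing O L
  let c := Module.Free.chooseBasis O L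
  let b := c.reindex (Fintype.equivFinOfCardEq
    (Module.finrank_eq_card_basis (c.extendOfIsLattice K)).symm)
  let ρL : W →+* Module.End O L :=
    { toFun := fun w => ((ρ w).restrictScalars O).restrict (hL w)
      map_one' := LinearMap.ext fun x => Subtype.ext (LinearMap.congr_fun (map_one ρ) x)
      map_mul' := fun v w =>
        LinearMap.ext fun x => Subtype.ext (LinearMap.congr_fun (map_mul ρ v w) x)
      map_zero' := LinearMap.ext fun x => Subtype.ext (LinearMap.congr_fun (map_zero ρ) x)
      map_add' := fun v w =>
        LinearMap.ext fun x => Subtype.ext (LinearMap.congr_fun (map_add ρ v w) x) }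
  exact ⟨b.extendOfIsLattice K, (LinearMap.toMatrixAlgEquiv b).toRingEquiv.toRingHom.comp ρL,
    fun w => (toMatrix_extendOfIsLattice b (ρ w) (hL w)).symm⟩

end Lattice

section Trace

theorem trace_pi {K ι : Type*} [CommRing K] [Fintype ι] {M : ι → Type*} [∀ i, AddCommGroup (M i)]
    [∀ i, Module K (M i)] [∀ i, Module.Free K (M i)] [∀ i, Module.Finite K (M i)]
    (f : ∀ i, Module.End K (M i)) :
    LinearMap.trace K (∀ i, M i) (LinearMap.pi fun i => f i ∘ₗ LinearMap.proj i) =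
      ∑ i, LinearMap.trace K (M i) (f i) := by
  classical
  let b (i : ι) := Module.Free.chooseBasis K (M i)
  simp only [LinearMap.trace_eq_matrix_trace K (Pi.basis b),
    LinearMap.trace_eq_matrix_trace K (b _), Matrix.trace, Fintype.sum_sigma, Matrix.diag_apply,
    LinearMap.toMatrix_apply, Pi.basis_repr, LinearMap.pi_apply, LinearMap.comp_apply,
    LinearMap.proj_apply, Pi.basis_apply, Pi.single_eq_same]

theorem trace_lsmul_of_linearEquiv_pi {K B S P ι : Type*} [Field K] [Ring B] [Algebra K B]
    [AddCommGroup S] [Module B S] [Module K S] [IsScalarTower K B S] [FiniteDimensional K S]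
    [AddCommGroup P] [Module B P] [Module K P] [IsScalarTower K B P] [Fintype ι]
    (f : P ≃ₗ[B] (ι → S)) (b : B) :
    LinearMap.trace K P (Algebra.lsmul K K P b) =
      Fintype.card ι * LinearMap.trace K S (Algebra.lsmul K K S b) := by
  have hconj : (f.restrictScalars K).conj (Algebra.lsmul K K P b) =
      LinearMap.pi fun j => Algebra.lsmul K K S b ∘ₗ LinearMap.proj j := by
    ext x j
    simp [LinearEquiv.conj_apply]
  rw [← LinearMap.trace_conj' _ (f.restrictScalars K), hconj, trace_pi, Finset.sum_const,
    Finset.card_univ, nsmul_eq_mul]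

end Trace

namespace Irr

section Ring

variable {B : Type*} [Ring B]

instance isSimpleModule_rep (i : Irr B) : IsSimpleModule B i.Rep :=
  isSimpleModule_iff_isCoatom.mpr (Quotient.out i).2

theorem eq_of_linearEquiv {i j : Irr B} (e : i.Rep ≃ₗ[B] j.Rep) : i = j :=
  Quotient.out_equiv_out.mp ⟨e⟩

theorem exists_linearEquiv_rep (S : Type*) [AddCommGroup S] [Module B S] [IsSimpleModule B S] :
    ∃ i : Irr B, Nonempty (S ≃ₗ[B] i.Rep) := by
  obtain ⟨I, hI, ⟨e⟩⟩ := isSimpleModule_iff_quot_maximal.mp ‹IsSimpleModule B S›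
  let i : Irr B := Quotient.mk (simpleModuleSetoid B) ⟨I, hI.out⟩
  obtain ⟨f⟩ : Nonempty (i.Rep ≃ₗ[B] B ⧸ I) :=
    Quotient.mk_out (s := simpleModuleSetoid B) ⟨I, hI.out⟩
  exact ⟨i, ⟨e.trans f.symm⟩⟩

theorem eq_of_isotypicComponent_eq {N : Type*} [AddCommGroup N] [Module B N] {i j : Irr B}
    (h : isotypicComponent B N i.Rep = isotypicComponent B N j.Rep)
    (hi : isotypicComponent B N i.Rep ≠ ⊥) : i = j := by
  obtain ⟨S, hS, _⟩ := (IsSemisimpleModule.eq_bot_or_exists_simple_le _).resolve_left hi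
  obtain ⟨e⟩ := isIsotypicOfType_submodule_iff.mp (.isotypicComponent B N i.Rep) S hS
  obtain ⟨f⟩ := isIsotypicOfType_submodule_iff.mp (.isotypicComponent B N j.Rep) S (h ▸ hS)
  exact eq_of_linearEquiv (e.symm.trans f)

theorem isotypicComponent_mem_isotypicComponents {N : Type*} [AddCommGroup N] [Module B N]
    {i : Irr B} (hi : isotypicComponent B N i.Rep ≠ ⊥) :
    isotypicComponent B N i.Rep ∈ isotypicComponents B N := by
  obtain ⟨S, hS, _⟩ := (IsSemisimpleModule.eq_bot_or_exists_simple_le _).resolve_left hi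
  obtain ⟨e⟩ := isIsotypicOfType_submodule_iff.mp (.isotypicComponent B N i.Rep) S hS
  exact ⟨S, ‹_›, e.isotypicComponent_eq.symm⟩

theorem iSup_isotypicComponent_rep_eq_top [IsSemisimpleRing B] (N : Type*) [AddCommGroup N]
    [Module B N] : ⨆ i : Irr B, isotypicComponent B N i.Rep = ⊤ := by
  rw [← top_le_iff, ← sSup_isotypicComponents B N]
  refine sSup_le ?_
  rintro _ ⟨S, _, rfl⟩
  obtain ⟨i, ⟨e⟩⟩ := exists_linearEquiv_rep (B := B) S
  rw [e.isotypicComponent_eq]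
  exact le_iSup (fun i : Irr B => isotypicComponent B N i.Rep) i

theorem iSupIndep_isotypicComponent_rep (N : Type*) [AddCommGroup N]
    [Module B N] : iSupIndep fun i : Irr B => isotypicComponent B N i.Rep := by
  intro i
  by_cases hi : isotypicComponent B N i.Rep = ⊥
  · simp only [hi, disjoint_bot_left]
  refine (sSupIndep_isotypicComponents B N (isotypicComponent_mem_isotypicComponents hi)).mono_right
    (iSup₂_le fun j hj => ?_)
  by_cases hjbot : isotypicComponent B N j.Rep = ⊥
  · exact hjbot.le.trans bot_le
  exact le_sSup ⟨isotypicComponent_mem_isotypicComponents hjbot,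
    fun h => hj (eq_of_isotypicComponent_eq h hjbot)⟩

instance finite [IsSemisimpleRing B] : Finite (Irr B) := by
  have hne (i : Irr B) : isotypicComponent B B i.Rep ≠ ⊥ := by
    obtain ⟨I, ⟨e⟩⟩ := IsSemisimpleRing.exists_linearEquiv_ideal_of_isSimpleModule B i.Rep
    have := IsSimpleModule.congr e.symm
    rw [e.isotypicComponent_eq]
    exact (bot_lt_isotypicComponent I).ne'
  exact Finite.of_injective
    (fun i : Irr B => (⟨_, isotypicComponent_mem_isotypicComponents (hne i)⟩ :
      isotypicComponents B B))
    fun i j h => eq_of_isotypicComponent_eq (Subtype.ext_iff.mp h) (hne i)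

theorem eq_zero_of_forall_rep_smul_eq_zero [IsSemisimpleRing B] {b : B}
    (hb : ∀ i : Irr B, ∀ x : i.Rep, b • x = 0) : b = 0 := by
  have h : b ∈ Ring.jacobson B := by
    refine Submodule.mem_sInf.mpr fun I hI => ?_
    have : IsSimpleModule B (B ⧸ I) := isSimpleModule_iff_isCoatom.mpr hI
    obtain ⟨i, ⟨e⟩⟩ := exists_linearEquiv_rep (B := B) (B ⧸ I)
    have h1 : b • (Submodule.Quotient.mk 1 : B ⧸ I) = 0 :=
      e.injective (by rw [map_smul, hb, map_zero])
    rwa [← Submodule.Quotient.mk_smul, smul_eq_mul, mul_one, Submodule.Quotient.mk_eq_zero] at h1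
  rwa [IsArtinianRing.isSemisimpleRing_iff_jacobson.mp ‹_›] at h

end Ring

section Algebra

variable (K B : Type*) [Field K] [Ring B] [Algebra K B]

/-- The action of an algebra on the product of its simple modules, one from each isomorphism
class. -/
noncomputable def action : B →ₐ[K] Π i : Irr B, Module.End K i.Rep :=
  AlgHom.pi fun i => Algebra.lsmul K K i.Rep

variable {K B}

theorem exists_forall_apply_eq_smul [IsAlgClosed K] [FiniteDimensional K B] [IsSemisimpleRing B]
    (g : Module.End B (Π i : Irr B, i.Rep)) (i : Irr B) :
    ∃ c : K, ∀ x, g x i = c • x i := by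
  classical
  have := Fintype.ofFinite (Irr B)
  obtain ⟨c, hc⟩ := (IsSimpleModule.algebraMap_end_bijective_of_isAlgClosed (V := i.Rep) K).2
    (LinearMap.proj i ∘ₗ g ∘ₗ LinearMap.single B _ i)
  have hsingle (j : Irr B) (y : j.Rep) (hj : j ≠ i) : g (Pi.single j y) i = 0 :=
    LinearMap.congr_fun ((LinearMap.bijective_or_eq_zero
      (LinearMap.proj i ∘ₗ g ∘ₗ LinearMap.single B _ j)).resolve_left fun h =>
        hj (eq_of_linearEquiv (.ofBijective _ h))) y
  refine ⟨c, fun x => ?_⟩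
  calc g x i = ∑ j, g (Pi.single j (x j)) i := by
        rw [← Finset.sum_apply, ← map_sum, Finset.univ_sum_single]
    _ = g (Pi.single i (x i)) i := Fintype.sum_eq_single i fun j hj => hsingle j _ hj
    _ = c • x i := (LinearMap.congr_fun hc (x i)).symm

theorem bijective_action [IsAlgClosed K] [FiniteDimensional K B] [IsSemisimpleRing B] :
    Function.Bijective (action K B) := by
  refine ⟨(injective_iff_map_eq_zero _).mpr fun b hb => eq_zero_of_forall_rep_smul_eq_zero
    fun i => LinearMap.congr_fun (congrFun hb i), fun f => ?_⟩
  classical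
  let M := Π i : Irr B, i.Rep
  have := Fintype.ofFinite (Irr B)
  have : Module.Finite (Module.End B M) M := .of_restrictScalars_finite K _ _
  let F : Module.End (Module.End B M) M :=
    { toFun := fun x i => f i (x i)
      map_add' := fun x y => funext fun i => map_add (f i) (x i) (y i)
      map_smul' := fun g x => funext fun i => by
        obtain ⟨c, hc⟩ := exists_forall_apply_eq_smul (K := K) g i
        simp only [Module.End.smul_def, RingHom.id_apply, hc, map_smul] }
  obtain ⟨b, hb⟩ := Module.Finite.toModuleEnd_moduleEnd_surjective F
  refine ⟨b, funext fun i => LinearMap.ext fun x => ?_⟩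
  have h : b • (Pi.single i x : M) i = f i ((Pi.single i x : M) i) :=
    congrFun (LinearMap.congr_fun hb (Pi.single i x)) i
  rwa [Pi.single_eq_same] at h

theorem trace_lsmul_isotypicComponent [FiniteDimensional K B] (i : Irr B) (N : Type*)
    [AddCommGroup N] [Module B N] [Module K N] [IsScalarTower K B N] [FiniteDimensional K N]
    (b : B) :
    LinearMap.trace K (isotypicComponent B N i.Rep)
      (Algebra.lsmul K K (isotypicComponent B N i.Rep) b) =
      i.multiplicity N * LinearMap.trace K i.Rep (Algebra.lsmul K K i.Rep b) := by
  have : Module.Finite B N := .of_restrictScalars_finite K B N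
  have := IsArtinianRing.of_finite K B
  obtain ⟨m, ⟨f⟩⟩ := (IsIsotypicOfType.isotypicComponent B N i.Rep).linearEquiv_fun
  have hm : i.multiplicity N = m := by
    rw [Irr.multiplicity, f.length_eq, Module.length_pi]
    simp
  rw [trace_lsmul_of_linearEquiv_pi f, Fintype.card_fin, hm]

theorem trace_lsmul_eq_sum [FiniteDimensional K B] [IsSemisimpleRing B] [Fintype (Irr B)]
    (N : Type*) [AddCommGroup N] [Module B N] [Module K N] [IsScalarTower K B N]
    [FiniteDimensional K N] (b : B) :
    LinearMap.trace K N (Algebra.lsmul K K N b) = ∑ i : Irr B,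
      (i.multiplicity N : K) * LinearMap.trace K i.Rep (Algebra.lsmul K K i.Rep b) := by
  classical
  have h : DirectSum.IsInternal fun i : Irr B => (isotypicComponent B N i.Rep).restrictScalars K :=
    DirectSum.isInternal_submodule_of_iSupIndep_of_iSup_eq_top
      (A := fun i : Irr B => isotypicComponent B N i.Rep)
      (iSupIndep_isotypicComponent_rep (B := B) N) (iSup_isotypicComponent_rep_eq_top N)
  rw [LinearMap.trace_eq_sum_trace_restrict h
    fun i x hx => (isotypicComponent B N i.Rep).smul_mem b hx]
  exact Finset.sum_congr rfl fun i _ => trace_lsmul_isotypicComponent i N b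

end Algebra
end Irr

section IntegralRepresentation

variable {O W I : Type*} [CommRing O] [Ring W] {d : I → ℕ}
  (ψ : ∀ i, W →+* Matrix (Fin (d i)) (Fin (d i)) O)

/-- The scalar extension to an `O`-algebra `S` of a family of matrix representations over `O`. -/
noncomputable def scalarExtension (S : Type*) [CommRing S] [Algebra O S] :
    S ⊗[ℤ] W →ₐ[S] Π i, Matrix (Fin (d i)) (Fin (d i)) S :=
  Algebra.TensorProduct.lift (Algebra.ofId S _)
    (RingHom.toIntAlgHom (RingHom.pi fun i => (algebraMap O S).mapMatrix.comp (ψ i)))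
    fun a _ => by
      rw [Algebra.ofId_apply]
      exact Algebra.commute_algebraMap_left a _

theorem scalarExtension_tmul (S : Type*) [CommRing S] [Algebra O S] (s : S) (w : W) (i : I) :
    scalarExtension ψ S (s ⊗ₜ w) i = s • (ψ i w).map (algebraMap O S) := by
  rw [scalarExtension, Algebra.TensorProduct.lift_tmul, Algebra.ofId_apply, ← Algebra.smul_def]
  rfl

theorem scalarExtension_map {S : Type*} [CommRing S] [Algebra O S] (x : O ⊗[ℤ] W) (i : I) :
    scalarExtension ψ S (Algebra.TensorProduct.map (RingHom.toIntAlgHom (algebraMap O S))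
      (AlgHom.id ℤ W) x) i = (scalarExtension ψ O x i).map (algebraMap O S) := by
  induction x using TensorProduct.induction_on with
  | zero => simp
  | add x y hx hy =>
    rw [map_add, map_add, map_add, Pi.add_apply, Pi.add_apply, hx, hy,
      Matrix.map_add _ (map_add (algebraMap O S))]
  | tmul a w =>
    rw [Algebra.TensorProduct.map_tmul, scalarExtension_tmul, scalarExtension_tmul]
    ext a b
    simp

theorem injective_scalarExtension_of_injective {K : Type*} [CommRing K] [Algebra O K]
    (hO : Function.Injective (algebraMap O K)) [Module.Flat ℤ W]
    (hK : Function.Injective (scalarExtension ψ K)) :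
    Function.Injective (scalarExtension ψ O) := by
  intro x y hxy
  refine Module.Flat.rTensor_preserves_injective_linearMap
    (RingHom.toIntAlgHom (algebraMap O K)).toLinearMap hO (hK (funext fun i => ?_))
  exact (scalarExtension_map ψ x i).trans
    ((congrArg (·.map (algebraMap O K)) (congrFun hxy i)).trans (scalarExtension_map ψ y i).symm)

theorem aeval_prod_charpoly_scalarExtension [Fintype I]
    (hψ : Function.Injective (scalarExtension ψ O)) (x : O ⊗[ℤ] W) :
    Polynomial.aeval x (∏ i, (scalarExtension ψ O x i).charpoly) = 0 := by
  refine hψ (funext fun i => ?_)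
  let φ := (Pi.evalAlgHom O (fun i => Matrix (Fin (d i)) (Fin (d i)) O) i).comp
    (scalarExtension ψ O)
  change φ _ = scalarExtension ψ O 0 i
  obtain ⟨r, hr⟩ := Finset.dvd_prod_of_mem (fun i => (scalarExtension ψ O x i).charpoly)
    (Finset.mem_univ i)
  rw [← Polynomial.aeval_algHom_apply, hr, map_mul, map_zero]
  exact mul_eq_zero_of_left (Matrix.aeval_self_charpoly _) _

-- The product of the characteristic polynomials of a lift of `y` annihilates that lift and reduces
-- to a power of `X`.
theorem isNilpotent_of_scalarExtension_eq_zero [Finite I] {κ : Type*} [CommRing κ] [Algebra O κ]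
    (hκ : Function.Surjective (algebraMap O κ)) (hψ : Function.Injective (scalarExtension ψ O))
    {y : κ ⊗[ℤ] W} (hy : scalarExtension ψ κ y = 0) : IsNilpotent y := by
  have := Fintype.ofFinite I
  let π := Algebra.TensorProduct.map (RingHom.toIntAlgHom (algebraMap O κ)) (AlgHom.id ℤ W)
  obtain ⟨x, rfl⟩ : ∃ x, π x = y :=
    TensorProduct.map_surjective (g := (RingHom.toIntAlgHom (algebraMap O κ)).toLinearMap)
      (g' := (AlgHom.id ℤ W).toLinearMap) hκ Function.surjective_id y
  have hmap : (∏ i, (scalarExtension ψ O x i).charpoly).map (algebraMap O κ) =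
      Polynomial.X ^ ∑ i, d i := by
    rw [Polynomial.map_prod, ← Finset.prod_pow_eq_pow_sum]
    refine Finset.prod_congr rfl fun i _ => ?_
    have hi : (scalarExtension ψ O x i).map (algebraMap O κ) = 0 :=
      (scalarExtension_map ψ x i).symm.trans (congrFun hy i)
    rw [← Matrix.charpoly_map, hi, Matrix.charpoly_zero, Fintype.card_fin]
  have h := Polynomial.map_aeval_eq_aeval_map (φ := algebraMap O κ) (ψ := π.toRingHom)
    (by ext; simp [π, Algebra.TensorProduct.algebraMap_apply])
    (∏ i, (scalarExtension ψ O x i).charpoly) x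
  rw [aeval_prod_charpoly_scalarExtension ψ hψ, hmap, map_zero, map_pow, Polynomial.aeval_X] at h
  exact ⟨_, h.symm⟩

theorem isSemisimpleRing_iff_bijective_scalarExtension [Finite I] {κ : Type*} [Field κ]
    [Algebra O κ] (hκ : Function.Surjective (algebraMap O κ))
    (hψ : Function.Injective (scalarExtension ψ O))
    [Module.Finite ℤ W] (hrank : Module.finrank κ (κ ⊗[ℤ] W) =
      Module.finrank κ (Π i, Matrix (Fin (d i)) (Fin (d i)) κ)) :
    IsSemisimpleRing (κ ⊗[ℤ] W) ↔ Function.Bijective (scalarExtension ψ κ) := by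
  refine ⟨fun _ => ?_, fun h => (AlgEquiv.ofBijective _ h).symm.toRingEquiv.isSemisimpleRing⟩
  have hinj : Function.Injective (scalarExtension ψ κ) := by
    refine (injective_iff_map_eq_zero _).mpr fun y hy =>
      eq_zero_of_forall_isNilpotent_mul fun a => ?_
    exact isNilpotent_of_scalarExtension_eq_zero ψ hκ hψ (by rw [map_mul, hy, mul_zero])
  exact ⟨hinj, (LinearMap.injective_iff_surjective_of_finrank_eq_finrank
    (f := (scalarExtension ψ κ).toLinearMap) hrank).mp hinj⟩

variable [Fintype I]

/-- The standard basis of a product of matrix algebras. -/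
noncomputable def piMatrixBasis (S : Type*) [CommRing S] (d : I → ℕ) :
    Module.Basis (Σ i, Fin (d i) × Fin (d i)) S (Π i, Matrix (Fin (d i)) (Fin (d i)) S) :=
  Pi.basis fun i => Matrix.stdBasis S (Fin (d i)) (Fin (d i))

theorem piMatrixBasis_repr (S : Type*) [CommRing S] (x : Π i, Matrix (Fin (d i)) (Fin (d i)) S)
    (t : Σ i, Fin (d i) × Fin (d i)) : (piMatrixBasis S d).repr x t = x t.1 t.2.1 t.2.2 := by
  rw [piMatrixBasis, Pi.basis_repr]
  rfl

/-- The matrix of entries of a family of matrices, one column for each of them. -/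
def entryMatrix {ι S : Type*} (x : ι → Π i, Matrix (Fin (d i)) (Fin (d i)) S) :
    Matrix (Σ i, Fin (d i) × Fin (d i)) ι S :=
  Matrix.of fun t r => x r t.1 t.2.1 t.2.2

variable [DecidableEq I] (b : Module.Basis (Σ i, Fin (d i) × Fin (d i)) ℤ W)

theorem toMatrix_scalarExtension (S : Type*) [CommRing S] [Algebra O S] :
    LinearMap.toMatrix (Algebra.TensorProduct.basis S b) (piMatrixBasis S d)
      (scalarExtension ψ S).toLinearMap =
      (entryMatrix fun r i => ψ i (b r)).map (algebraMap O S) := by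
  ext t r
  rw [LinearMap.toMatrix_apply, piMatrixBasis_repr, Algebra.TensorProduct.basis_apply,
    AlgHom.toLinearMap_apply, scalarExtension_tmul, one_smul]
  rfl

theorem bijective_scalarExtension_iff (S : Type*) [CommRing S] [Algebra O S] :
    Function.Bijective (scalarExtension ψ S) ↔
      IsUnit (algebraMap O S (entryMatrix fun r i => ψ i (b r)).det) := by
  rw [RingHom.map_det, RingHom.mapMatrix_apply, ← toMatrix_scalarExtension]
  exact ⟨fun h => (LinearEquiv.ofBijective (scalarExtension ψ S).toLinearMap h).isUnit_det _ _,
    fun h => (LinearEquiv.ofIsUnitDet h).bijective⟩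

theorem isSemisimpleRing_iff_isUnit_det_entryMatrix {κ : Type*} [Field κ] [Algebra O κ]
    (hκ : Function.Surjective (algebraMap O κ)) [IsLocalHom (algebraMap O κ)]
    (hψ : Function.Injective (scalarExtension ψ O)) :
    IsSemisimpleRing (κ ⊗[ℤ] W) ↔ IsUnit (entryMatrix fun r i => ψ i (b r)).det := by
  have : Module.Finite ℤ W := .of_basis b
  have hrank := (Module.finrank_eq_card_basis (Algebra.TensorProduct.basis κ b)).trans
    (Module.finrank_eq_card_basis (piMatrixBasis κ d)).symm
  rw [isSemisimpleRing_iff_bijective_scalarExtension ψ hκ hψ hrank,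
    bijective_scalarExtension_iff ψ b, isUnit_map_iff]

end IntegralRepresentation

section TraceForm

variable {R I : Type*} [CommRing R] [Fintype I] {d : I → ℕ} (m : I → R)

/-- The transposition of the matrices in a product of matrix algebras, on matrix positions. -/
def transposePositions (d : I → ℕ) : Equiv.Perm (Σ i, Fin (d i) × Fin (d i)) :=
  Equiv.sigmaCongrRight fun _ => Equiv.prodComm _ _

theorem sum_mul_trace_mul_eq [DecidableEq I] {ι : Type*}
    (x : ι → Π i, Matrix (Fin (d i)) (Fin (d i)) R) :
    Matrix.of (fun r s => ∑ i, m i * (x r i * x s i).trace) =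
      (entryMatrix x)ᵀ * Matrix.diagonal (fun t : Σ i, Fin (d i) × Fin (d i) => m t.1) *
        (entryMatrix x).submatrix (transposePositions d) id := by
  ext r s
  rw [Matrix.of_apply, Matrix.mul_apply]
  simp only [Matrix.mul_diagonal, Fintype.sum_sigma, Fintype.sum_prod_type]
  simp only [Matrix.trace, Matrix.diag_apply, Matrix.mul_apply, Finset.mul_sum]
  refine Finset.sum_congr rfl fun i _ => Finset.sum_congr rfl fun a _ =>
    Finset.sum_congr rfl fun c _ => ?_
  change m i * (x r i a c * x s i c a) = x r i a c * m i * x s i c a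
  ring

theorem det_sum_mul_trace_mul [DecidableEq I]
    (x : (Σ i, Fin (d i) × Fin (d i)) → Π i, Matrix (Fin (d i)) (Fin (d i)) R) :
    (Matrix.of fun r s => ∑ i, m i * (x r i * x s i).trace).det =
      (Equiv.Perm.sign (transposePositions d) : ℤ) * (∏ i, m i ^ d i ^ 2) *
        (entryMatrix x).det ^ 2 := by
  have hprod : ∏ t : Σ i, Fin (d i) × Fin (d i), m t.1 = ∏ i, m i ^ d i ^ 2 := by
    simp [Fintype.prod_sigma, sq]
  rw [sum_mul_trace_mul_eq, Matrix.det_mul, Matrix.det_mul, Matrix.det_transpose,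
    Matrix.det_diagonal, Matrix.det_permute, hprod]
  ring

end TraceForm

namespace Irr

section Gram

variable {O K W B : Type*} [CommRing O] [Field K] [Algebra O K] [Ring W] [Ring B] [Algebra K B]
  [FiniteDimensional K B] [IsSemisimpleRing B] (e : K ⊗[ℤ] W ≃ₐ[K] B)

theorem exists_integral_bijective_scalarExtension (O : Type*) [CommRing O] [IsDomain O]
    [ValuationRing O] [Algebra O K] [IsFractionRing O K] [IsAlgClosed K] [Module.Finite ℤ W] :
    ∃ ψ : ∀ i : Irr B,
      W →+* Matrix (Fin (Module.finrank K i.Rep)) (Fin (Module.finrank K i.Rep)) O,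
      Function.Bijective (scalarExtension ψ K) ∧ ∀ i w,
        LinearMap.trace K i.Rep (Algebra.lsmul K K i.Rep (e (1 ⊗ₜ w))) =
          algebraMap O K (ψ i w).trace := by
  let ρ (i : Irr B) : W →+* Module.End K i.Rep :=
    ((Algebra.lsmul K K i.Rep).toRingHom.comp e.toRingHom).comp
      (Algebra.TensorProduct.includeRight : W →ₐ[ℤ] K ⊗[ℤ] W).toRingHom
  choose c ψ hψ using fun i => exists_integral_matrix_representation O (ρ i)
  let θ : (Π i : Irr B, Module.End K i.Rep) ≃ₐ[K]
      Π i : Irr B, Matrix (Fin (Module.finrank K i.Rep)) (Fin (Module.finrank K i.Rep)) K :=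
    AlgEquiv.piCongrRight fun i => LinearMap.toMatrixAlgEquiv (c i)
  have hθ : scalarExtension ψ K = (θ.toAlgHom.comp (action K B)).comp e.toAlgHom := by
    refine Algebra.TensorProduct.ext (by ext) (AlgHom.ext fun w => funext fun i => ?_)
    exact (scalarExtension_tmul ψ K 1 w i).trans ((one_smul _ _).trans (hψ i w))
  refine ⟨ψ, ?_, fun i w => ?_⟩
  · rw [hθ]
    exact (θ.bijective.comp bijective_action).comp e.bijective
  · rw [AddMonoidHom.map_trace, hψ, ← LinearMap.trace_eq_matrix_trace]
    rfl

variable [Fintype (Irr B)] (N : Type*) [AddCommGroup N] [Module B N]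
  [Module K N] [IsScalarTower K B N] [FiniteDimensional K N]

theorem det_trace_lsmul_mul_eq [DecidableEq (Irr B)]
    {ψ : ∀ i : Irr B, W →+* Matrix (Fin (Module.finrank K i.Rep)) (Fin (Module.finrank K i.Rep)) O}
    (hψ : ∀ i w, LinearMap.trace K i.Rep (Algebra.lsmul K K i.Rep (e (1 ⊗ₜ w))) =
      algebraMap O K (ψ i w).trace)
    (b : (Σ i : Irr B, Fin (Module.finrank K i.Rep) × Fin (Module.finrank K i.Rep)) → W) :
    (Matrix.of fun r s =>
      LinearMap.trace K N (Algebra.lsmul K K N (e (1 ⊗ₜ (b r * b s))))).det =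
      (Equiv.Perm.sign (transposePositions fun i : Irr B => Module.finrank K i.Rep) : ℤ) *
        (∏ i : Irr B, (i.multiplicity N : K) ^ Module.finrank K i.Rep ^ 2) *
        algebraMap O K (entryMatrix fun r i => ψ i (b r)).det ^ 2 := by
  have h := congrArg (algebraMap O K)
    (det_sum_mul_trace_mul (fun i : Irr B => (i.multiplicity N : O)) fun r i => ψ i (b r))
  simp only [map_mul, map_pow, map_prod, map_natCast, map_intCast] at h
  rw [← h, RingHom.map_det]
  congr 1
  ext r s
  simp only [trace_lsmul_eq_sum (K := K) N, hψ, map_mul, Matrix.of_apply, map_sum, map_natCast,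
    RingHom.mapMatrix_apply, Matrix.map_apply]

theorem exists_det_trace_lsmul_mul_eq [IsDomain O] [ValuationRing O] [IsFractionRing O K]
    [IsAlgClosed K] {ι : Type*} [Fintype ι] [DecidableEq ι] (b : Module.Basis ι ℤ W)
    (κ : Type*) [Field κ] [Algebra O κ] (hκ : Function.Surjective (algebraMap O κ))
    [IsLocalHom (algebraMap O κ)] :
    ∃ (ε : ℤˣ) (x : O), x ≠ 0 ∧
      (Matrix.of fun r s =>
        LinearMap.trace K N (Algebra.lsmul K K N (e (1 ⊗ₜ (b r * b s))))).det =
        (ε : ℤ) * (∏ i : Irr B, (i.multiplicity N : K) ^ Module.finrank K i.Rep ^ 2) *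
          algebraMap O K x ^ 2 ∧
      (IsSemisimpleRing (κ ⊗[ℤ] W) ↔ IsUnit x) := by
  classical
  have : Module.Finite ℤ W := .of_basis b
  have : Module.Free ℤ W := .of_basis b
  obtain ⟨ψ, hbij, htrace⟩ := exists_integral_bijective_scalarExtension e O
  let σ := ((Algebra.TensorProduct.basis K b).map
    (AlgEquiv.ofBijective _ hbij).toLinearEquiv).indexEquiv (piMatrixBasis K _)
  have hinj := injective_scalarExtension_of_injective ψ (IsFractionRing.injective O K) hbij.1
  refine ⟨Equiv.Perm.sign (transposePositions fun i : Irr B => Module.finrank K i.Rep),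
    (entryMatrix fun r i => ψ i (b.reindex σ r)).det, fun h0 => ?_, ?_,
    isSemisimpleRing_iff_isUnit_det_entryMatrix ψ (b.reindex σ) hκ hinj⟩
  · have h := (bijective_scalarExtension_iff ψ (b.reindex σ) K).mp hbij
    rw [h0, map_zero] at h
    exact not_isUnit_zero h
  · rw [← det_trace_lsmul_mul_eq e N htrace, ← Matrix.det_reindex_self σ]
    simp only [Matrix.reindex_apply, Module.Basis.reindex_apply]
    rfl

end Gram

end Irr

namespace CoherentConfiguration

variable {V : Type*} [Fintype V] [DecidableEq V] (C : CoherentConfiguration V)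

theorem eq_of_mem_of_mem {R S : Finset (V × V)} (hR : R ∈ C.rels) (hS : S ∈ C.rels) {x : V × V}
    (hxR : x ∈ R) (hxS : x ∈ S) : R = S :=
  (C.existsUnique_mem x).unique ⟨hR, hxR⟩ ⟨hS, hxS⟩

/-- The adjacency matrix of a basis relation, as an element of the adjacency ring. -/
def adjacency (R : C.rels) : C.adjacencyRing :=
  ⟨adjacencyMatrix R.1, Submodule.subset_span ⟨R.1, R.2, rfl⟩⟩

theorem linearIndependent_adjacencyMatrix :
    LinearIndependent ℤ fun R : C.rels => adjacencyMatrix R.1 := by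
  rw [Fintype.linearIndependent_iff]
  intro c hc R
  obtain ⟨⟨u, v⟩, huv⟩ := C.nonempty_of_mem R.1 R.2
  have := congrFun (congrFun hc u) v
  rw [Matrix.sum_apply, Finset.sum_eq_single R] at this
  · simpa [adjacencyMatrix, huv] using this
  · intro S _ hS
    have : (u, v) ∉ S.1 := fun h => hS (Subtype.ext (C.eq_of_mem_of_mem S.2 R.2 h huv))
    simp [adjacencyMatrix, this]
  · simp

/-- The adjacency matrices of the basis relations form a basis of the adjacency ring. -/
noncomputable def adjacencyBasis : Module.Basis C.rels ℤ C.adjacencyRing :=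
  Module.Basis.mk (v := C.adjacency)
    (LinearIndependent.of_comp C.adjacencyRing.val.toLinearMap
      C.linearIndependent_adjacencyMatrix)
    (by
      rintro ⟨x, hx⟩ -
      have hx' : x ∈ Submodule.span ℤ (adjacencyMatrix '' (C.rels : Set (Finset (V × V)))) := hx
      have hmap : (Submodule.span ℤ (Set.range C.adjacency)).map C.adjacencyRing.val.toLinearMap =
          Submodule.span ℤ (adjacencyMatrix '' (C.rels : Set (Finset (V × V)))) := by
        rw [Submodule.map_span, ← Set.range_comp]
        congr 1
        ext y
        simp [adjacency]
      rw [← hmap] at hx'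
      obtain ⟨y, hy, rfl⟩ := hx'
      exact hy)

@[simp]
theorem adjacencyBasis_apply (R : C.rels) : C.adjacencyBasis R = C.adjacency R := by
  simp [adjacencyBasis]

instance : Module.Free ℤ C.adjacencyRing := .of_basis C.adjacencyBasis

instance : Module.Finite ℤ C.adjacencyRing := .of_basis C.adjacencyBasis

/-- Transposition of basis relations. -/
def transposeRel : Equiv.Perm C.rels :=
  Function.Involutive.toPerm (fun R => ⟨R.1.image Prod.swap, C.transpose_mem R.1 R.2⟩)
    fun R => Subtype.ext (by simp [Finset.image_image])

theorem mem_transposeRel (R : C.rels) (u v : V) :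
    (u, v) ∈ (C.transposeRel R).1 ↔ (v, u) ∈ R.1 := by
  change (u, v) ∈ R.1.image Prod.swap ↔ _
  simp

theorem transposeRel_transposeRel (R : C.rels) : C.transposeRel (C.transposeRel R) = R :=
  C.transposeRel.symm_apply_apply R

theorem trace_adjacency_mul (R S : C.rels) :
    (C.adjacency R * C.adjacency S : Matrix V V ℤ).trace =
      if S = C.transposeRel R then (R.1.card : ℤ) else 0 := by
  have h : (C.adjacency R * C.adjacency S : Matrix V V ℤ).trace =
      ∑ x : V × V, if x ∈ R.1 ∧ x.swap ∈ S.1 then (1 : ℤ) else 0 := by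
    rw [Fintype.sum_prod_type]
    simp only [Matrix.trace, Matrix.diag_apply, Matrix.mul_apply]
    refine Finset.sum_congr rfl fun u _ => Finset.sum_congr rfl fun v _ => ?_
    by_cases h1 : (u, v) ∈ R.1 <;> by_cases h2 : (v, u) ∈ S.1 <;>
      simp [adjacency, adjacencyMatrix, h1, h2]
  rw [h]
  split_ifs with hS
  · have hmem (x : V × V) : (x ∈ R.1 ∧ x.swap ∈ S.1) ↔ x ∈ R.1 := by
      rw [hS, ← Prod.mk.eta (p := x), Prod.swap_prod_mk, mem_transposeRel, and_self]
    simp [hmem]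
  · refine Finset.sum_eq_zero fun x _ => if_neg fun ⟨h1, h2⟩ => hS (Subtype.ext ?_)
    exact C.eq_of_mem_of_mem S.2 (C.transposeRel R).2 h2 ((C.mem_transposeRel R x.2 x.1).2 h1)

theorem det_trace_adjacency_mul :
    (Matrix.of fun R S => (C.adjacency R * C.adjacency S : Matrix V V ℤ).trace).det =
      Equiv.Perm.sign C.transposeRel * ∏ R : C.rels, (R.1.card : ℤ) := by
  have h : (Matrix.of fun R S => (C.adjacency R * C.adjacency S : Matrix V V ℤ).trace) =
      (Matrix.diagonal fun R : C.rels => (R.1.card : ℤ)).submatrix id C.transposeRel := by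
    ext R S
    have hRS : S = C.transposeRel R ↔ R = C.transposeRel S := by
      constructor <;> rintro rfl <;> rw [transposeRel_transposeRel]
    simp only [Matrix.of_apply, trace_adjacency_mul, Matrix.submatrix_apply,
      Matrix.diagonal_apply, id, hRS]
  rw [h, Matrix.det_permute', Matrix.det_diagonal, Int.cast_id]

theorem trace_toMatrix_tmul (k : Type*) [Field k] (c : k) (w : C.adjacencyRing) :
    (C.toMatrix k (c ⊗ₜ w)).trace = c * ((w : Matrix V V ℤ).trace : k) := by
  have h : C.toMatrix k (c ⊗ₜ w) = c • (w : Matrix V V ℤ).map (Int.castRingHom k) := by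
    rw [toMatrix, Algebra.TensorProduct.lift_tmul, Algebra.ofId_apply, ← Algebra.smul_def]
    rfl
  rw [h, Matrix.trace_smul, smul_eq_mul, ← AddMonoidHom.map_trace]
  rfl

noncomputable instance (k : Type*) [Field k] : Module k (C.StandardModule k) :=
  inferInstanceAs (Module k (V → k))

instance (k : Type*) [Field k] : Module.Finite k (C.StandardModule k) :=
  inferInstanceAs (Module.Finite k (V → k))

instance (k : Type*) [Field k] :
    IsScalarTower k (C.adjacencyAlgebra k)ᵐᵒᵖ (C.StandardModule k) where
  smul_assoc c a x := by
    change Matrix.vecMul (show V → k from x) (C.toMatrix k (c • a).unop) =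
      c • Matrix.vecMul (show V → k from x) (C.toMatrix k a.unop)
    rw [MulOpposite.unop_smul, map_smul]
    exact Matrix.vecMul_smul _ _ _

theorem trace_lsmul_standardModule (k : Type*) [Field k] (a : C.adjacencyAlgebra k) :
    LinearMap.trace k (C.StandardModule k)
      (Algebra.lsmul k k (C.StandardModule k) (MulOpposite.op a)) = (C.toMatrix k a).trace := by
  have h : Algebra.lsmul k k (C.StandardModule k) (MulOpposite.op a) =
      (show Module.End k (V → k) from Matrix.toLin' (C.toMatrix k a)ᵀ) := by
    refine LinearMap.ext fun x => ?_
    exact (Matrix.mulVec_transpose (C.toMatrix k a) (show V → k from x)).symm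
  rw [h, ← Matrix.trace_transpose (C.toMatrix k a)]
  exact Matrix.trace_toLin'_eq _

theorem card_ne_zero (k : Type*) [Field k] [CharZero k] (R : C.rels) : (R.1.card : k) ≠ 0 :=
  Nat.cast_ne_zero.mpr (C.nonempty_of_mem R.1 R.2).card_ne_zero

instance isSemisimpleRing_adjacencyAlgebra (k : Type*) [Field k] [CharZero k] :
    IsSemisimpleRing (C.adjacencyAlgebra k) := by
  have := IsArtinianRing.of_finite k (C.adjacencyAlgebra k)
  refine isSemisimpleRing_of_forall_isNilpotent_mul fun x hx => ?_
  let b := Algebra.TensorProduct.basis k C.adjacencyBasis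
  refine b.ext_elem fun S => ?_
  have htrace (T : C.rels) : (C.toMatrix k (b (C.transposeRel S) * b T)).trace =
      if T = S then ((C.transposeRel S).1.card : k) else 0 := by
    rw [Algebra.TensorProduct.basis_apply, Algebra.TensorProduct.basis_apply, adjacencyBasis_apply,
      adjacencyBasis_apply, Algebra.TensorProduct.tmul_mul_tmul, trace_toMatrix_tmul,
      MulMemClass.coe_mul, trace_adjacency_mul, transposeRel_transposeRel, one_mul, one_mul,
      Int.cast_ite, Int.cast_natCast, Int.cast_zero]
  have h := (Matrix.isNilpotent_trace_of_isNilpotent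
    ((hx (b (C.transposeRel S))).map (C.toMatrix k))).eq_zero
  rw [← b.sum_repr x] at h
  simp only [Finset.mul_sum, mul_smul_comm, map_sum, map_smul, Matrix.trace_sum,
    Matrix.trace_smul, htrace, smul_ite, smul_zero, Finset.sum_ite_eq', Finset.mem_univ,
    if_true] at h
  simpa [C.card_ne_zero k] using h

end CoherentConfiguration

section ValuationSubring

theorem exists_valuationSubring_charP.{u} (K : Type u) [Field K] [CharZero K] {p : ℕ}
    (hp : p.Prime) : ∃ (O : ValuationSubring K) (κ : Type u) (_ : Field κ) (_ : Algebra O κ),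
      Function.Surjective (algebraMap O κ) ∧ IsLocalHom (algebraMap O κ) ∧ CharP κ p := by
  let A := (Int.castRingHom K).range
  have hI : Ideal.span {(p : A)} ≠ ⊤ := by
    rw [Ne, Ideal.span_singleton_eq_top, isUnit_iff_exists_inv]
    rintro ⟨⟨_, a, rfl⟩, ha⟩
    have ha' : ((p * a : ℤ) : K) = (1 : ℤ) := by
      push_cast
      exact congrArg Subtype.val ha
    exact (Nat.prime_iff_prime_int.mp hp).not_isUnit (.of_mul_eq_one a (Int.cast_injective ha'))
  obtain ⟨O, -, hO⟩ := Ideal.image_subset_nonunits_valuationSubring _ hI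
  obtain ⟨_, hmem⟩ := ValuationSubring.mem_nonunits_iff_exists_mem_maximalIdeal.mp
    (hO ⟨p, Ideal.mem_span_singleton_self _, map_natCast A.subtype p⟩)
  refine ⟨O, IsLocalRing.ResidueField O, inferInstance, inferInstance,
    IsLocalRing.residue_surjective, inferInstanceAs (IsLocalHom (IsLocalRing.residue O)),
    (CharP.charP_iff_prime_eq_zero hp).mpr ?_⟩
  rw [← map_natCast (IsLocalRing.residue O), IsLocalRing.residue_eq_zero_iff]
  exact hmem

theorem isUnit_intCast_iff_not_dvd {O : Type*} [CommRing O] (κ : Type*) [Field κ] [Algebra O κ]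
    [IsLocalHom (algebraMap O κ)] (p : ℕ) [CharP κ p] (n : ℤ) :
    IsUnit (n : O) ↔ ¬ (p : ℤ) ∣ n := by
  rw [← isUnit_map_iff (algebraMap O κ), map_intCast, isUnit_iff_ne_zero, Ne,
    CharP.intCast_eq_zero_iff _ p]

theorem isIntegral_int_of_forall_mem_valuationSubring {K : Type*} [Field K] {x : K}
    (hx : ∀ O : ValuationSubring K, x ∈ O) : IsIntegral ℤ x := by
  have : IsIntegrallyClosedIn (integralClosure ℤ K).toSubring K :=
    inferInstanceAs (IsIntegrallyClosedIn (integralClosure ℤ K) K)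
  by_contra h
  obtain ⟨O, -, hO⟩ := Subring.exists_le_valuationSubring_of_isIntegrallyClosedIn
    (R := (integralClosure ℤ K).toSubring) h
  exact hO (hx O)

theorem intCast_num_eq_of_forall_mem_valuationSubring (K : Type*) [Field K] [CharZero K] {q : ℚ}
    (hq : ∀ O : ValuationSubring K, (q : K) ∈ O) : (q.num : ℚ) = q := by
  have h : IsIntegral ℤ (algebraMap ℚ K q) :=
    isIntegral_int_of_forall_mem_valuationSubring fun O => by simpa using hq O
  obtain ⟨n, rfl⟩ := IsIntegrallyClosed.isIntegral_iff.mp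
    ((isIntegral_algebraMap_iff (algebraMap ℚ K).injective).mp h)
  simp

end ValuationSubring

namespace CoherentConfiguration

variable {V : Type*} [Fintype V] [DecidableEq V] (C : CoherentConfiguration V)

/-- The `k`-algebra isomorphism between `k ⊗ Wᵐᵒᵖ` and `(k ⊗ W)ᵐᵒᵖ`, through which right modules of
the adjacency algebra come from representations of `Wᵐᵒᵖ`. -/
noncomputable def opAdjacencyAlgebraEquiv (k : Type*) [Field k] :
    k ⊗[ℤ] C.adjacencyRingᵐᵒᵖ ≃ₐ[k] (C.adjacencyAlgebra k)ᵐᵒᵖ :=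
  (Algebra.TensorProduct.congr (AlgEquiv.toOpposite k k) AlgEquiv.refl).trans
    (Algebra.TensorProduct.opAlgEquiv ℤ k k C.adjacencyRing)

theorem isSemisimpleRing_tensorProduct_op_iff (k : Type*) [Field k] :
    IsSemisimpleRing (k ⊗[ℤ] C.adjacencyRingᵐᵒᵖ) ↔ IsSemisimpleRing (C.adjacencyAlgebra k) :=
  (C.opAdjacencyAlgebraEquiv k).toRingEquiv.isSemisimpleRing_iff.trans
    isSemisimpleRing_mulOpposite_iff

theorem det_trace_lsmul_standardModule (k : Type*) [Field k] :
    (Matrix.of fun R S => LinearMap.trace k (C.StandardModule k) (Algebra.lsmul k k _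
      (C.opAdjacencyAlgebraEquiv k
        (1 ⊗ₜ (C.adjacencyBasis.mulOpposite R * C.adjacencyBasis.mulOpposite S))))).det =
      (Equiv.Perm.sign C.transposeRel : ℤ) * ∏ R : C.rels, (R.1.card : k) := by
  have hentry (R S : C.rels) : LinearMap.trace k (C.StandardModule k) (Algebra.lsmul k k _
      (C.opAdjacencyAlgebraEquiv k
        (1 ⊗ₜ (C.adjacencyBasis.mulOpposite R * C.adjacencyBasis.mulOpposite S)))) =
      ((C.adjacency R * C.adjacency S : Matrix V V ℤ).trace : k) := by
    rw [Matrix.trace_mul_comm, ← one_mul (Int.cast _), ← MulMemClass.coe_mul,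
      ← trace_toMatrix_tmul, ← trace_lsmul_standardModule, ← adjacencyBasis_apply,
      ← adjacencyBasis_apply]
    rfl
  have h := congrArg (Int.castRingHom k) C.det_trace_adjacency_mul
  rw [RingHom.map_det] at h
  simp only [hentry]
  exact h.trans (by simp)

theorem frameNumber_eq_div [Fintype (Irr (C.adjacencyAlgebra ℂ)ᵐᵒᵖ)] :
    (C.frameNumber : ℂ) = (∏ R : C.rels, (R.1.card : ℂ)) /
      ∏ i : Irr (C.adjacencyAlgebra ℂ)ᵐᵒᵖ,
        (i.multiplicity (C.StandardModule ℂ) : ℂ) ^ Module.finrank ℂ i.Rep ^ 2 := by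
  rw [frameNumber, finprod_eq_prod_of_fintype, ← Finset.prod_coe_sort C.rels]
  push_cast
  rfl

theorem exists_coe_eq_frameNumber_and_isSemisimpleRing_iff (O : ValuationSubring ℂ)
    (κ : Type*) [Field κ] [Algebra O κ] (hκ : Function.Surjective (algebraMap O κ))
    [IsLocalHom (algebraMap O κ)] :
    ∃ x : O, x ≠ 0 ∧ (x : ℂ) = C.frameNumber ∧
      (IsSemisimpleRing (C.adjacencyAlgebra κ) ↔ IsUnit x) := by
  classical
  have := Fintype.ofFinite (Irr (C.adjacencyAlgebra ℂ)ᵐᵒᵖ)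
  obtain ⟨ε, y, hy, hdet, hiff⟩ := Irr.exists_det_trace_lsmul_mul_eq (O := O)
    (C.opAdjacencyAlgebraEquiv ℂ) (C.StandardModule ℂ) C.adjacencyBasis.mulOpposite κ hκ
  let δ := Equiv.Perm.sign C.transposeRel
  have hprod : ∏ R : C.rels, (R.1.card : ℂ) = ((δ * ε : ℤˣ) : ℤ) * (y : ℂ) ^ 2 *
      ∏ i : Irr (C.adjacencyAlgebra ℂ)ᵐᵒᵖ,
        (i.multiplicity (C.StandardModule ℂ) : ℂ) ^ Module.finrank ℂ i.Rep ^ 2 := by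
    have hδ : ((δ : ℤ) : ℂ) * (δ : ℤ) = 1 := by exact_mod_cast Int.units_coe_mul_self δ
    have hdet' := (C.det_trace_lsmul_standardModule ℂ).symm.trans hdet
    calc ∏ R : C.rels, (R.1.card : ℂ)
        = (δ : ℤ) * ((δ : ℤ) * ∏ R : C.rels, (R.1.card : ℂ)) := by rw [← mul_assoc, hδ, one_mul]
      _ = _ := by
        rw [hdet', Units.val_mul, Int.cast_mul, ValuationSubring.algebraMap_apply]
        ring
  have hne : ∏ R : C.rels, (R.1.card : ℂ) ≠ 0 :=
    Finset.prod_ne_zero_iff.mpr fun R _ => C.card_ne_zero ℂ R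
  have hunit : IsUnit (((δ * ε : ℤˣ) : ℤ) : O) := (δ * ε).isUnit.map (Int.castRingHom O)
  refine ⟨((δ * ε : ℤˣ) : ℤ) * y ^ 2, mul_ne_zero hunit.ne_zero (pow_ne_zero 2 hy), ?_, ?_⟩
  · rw [frameNumber_eq_div, hprod, mul_div_cancel_right₀ _ (right_ne_zero_of_mul (hprod ▸ hne))]
    push_cast
    rfl
  · rw [← isSemisimpleRing_tensorProduct_op_iff, hiff, IsUnit.mul_iff,
      isUnit_pow_iff two_ne_zero]
    exact (and_iff_right hunit).symm

theorem exists_ne_zero_coe_eq_frameNumber (O : ValuationSubring ℂ) :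
    ∃ x : O, x ≠ 0 ∧ (x : ℂ) = C.frameNumber := by
  have : IsLocalHom (algebraMap O (IsLocalRing.ResidueField O)) :=
    inferInstanceAs (IsLocalHom (IsLocalRing.residue O))
  obtain ⟨x, hx, hxF, -⟩ := C.exists_coe_eq_frameNumber_and_isSemisimpleRing_iff O
    (IsLocalRing.ResidueField O) IsLocalRing.residue_surjective
  exact ⟨x, hx, hxF⟩

theorem frameNumber_ne_zero : C.frameNumber ≠ 0 := by
  obtain ⟨x, hx, hxF⟩ := C.exists_ne_zero_coe_eq_frameNumber ⊤
  intro h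
  exact hx (Subtype.ext (by simpa [h] using hxF))

theorem intCast_num_frameNumber : (C.frameNumber.num : ℚ) = C.frameNumber :=
  intCast_num_eq_of_forall_mem_valuationSubring ℂ fun O => by
    obtain ⟨x, -, hxF⟩ := C.exists_ne_zero_coe_eq_frameNumber O
    exact hxF ▸ x.2

theorem isSemisimpleRing_adjacencyAlgebra_iff_of_prime {k : Type*} [Field k] {p : ℕ} [CharP k p]
    (hp : p.Prime) :
    IsSemisimpleRing (C.adjacencyAlgebra k) ↔ ¬ (p : ℤ) ∣ C.frameNumber.num := by
  have : Fact p.Prime := ⟨hp⟩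
  obtain ⟨O, κ, _, _, hκ, _, _⟩ := exists_valuationSubring_charP ℂ hp
  obtain ⟨x, -, hxF, hx⟩ := C.exists_coe_eq_frameNumber_and_isSemisimpleRing_iff O κ hκ
  have hxn : x = (C.frameNumber.num : O) := by
    refine Subtype.ext (hxF.trans ?_)
    rw [← C.intCast_num_frameNumber]
    simp
  rw [isSemisimpleRing_tensorProduct_iff_zmod k C.adjacencyRing p,
    ← isSemisimpleRing_tensorProduct_iff_zmod κ C.adjacencyRing p, hx, hxn,
    isUnit_intCast_iff_not_dvd κ p]

end CoherentConfiguration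

theorem theorem5p2 {V : Type*} [Fintype V] [DecidableEq V] (C : CoherentConfiguration V)
    {k : Type*} [Field k] (p : ℕ) [CharP k p] :
    ∃ n : ℤ, C.frameNumber = (n : ℚ) ∧
      (IsSemisimpleRing (C.adjacencyAlgebra k) ↔ ¬ (p : ℤ) ∣ n) := by
  refine ⟨C.frameNumber.num, C.intCast_num_frameNumber.symm, ?_⟩
  rcases CharP.char_is_prime_or_zero k p with hp | rfl
  · exact C.isSemisimpleRing_adjacencyAlgebra_iff_of_prime hp
  · have : CharZero k := CharP.charP_to_charZero k
    exact iff_of_true inferInstance (by simpa using C.frameNumber_ne_zero)
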